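/- For integers $m\ge 0$ and $k$, let $\left\langle{m\atop k}\right\rangle$ denote the Eulerian number, i.e. the number of permutations $\sigma$ of $\{1,\dots,m\}$ with exactly $k$ descents (indices $1\le i<m$ with $\sigma(i)>\sigma(i+1)$); in particular $\left\langle{0\atop 0}\right\rangle=1$, and $\left\langle{m\atop k}\right\rangle=0$ for $k<0$. **Theorem.** Let $n\ge 2$ and let $U_1,\dots,U_n$ be independent random variables, each uniformly distributed on $[0,1]$. Let $S_m:=\sum_{i=1}^m U_i$ for $0\le m\le n$, let $\overline U:=S_n/n$, and let $W_n:=\#\{i\le n: U_i>\overline U\}$ be the number of the $U_i$ that exceed their mean. Then: 1. for every integer $k\ge 0$, $$\mathbb P(W_n=k)=\frac{1}{(n-1)!}\left\langle{n-1\atop k-1}\right\rangle;$$ 2. $W_n-1$ and $\lfloor S_{n-1}\rfloor$ have the same distribution; 3. for every $0\le m\le n$ and every integer $k\ge 0$, $$\mathbb P(\lfloor S_m\rfloor=k)=\frac{1}{m!}\left\langle{m\atop k}\right\rangle.$$ -/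

import Mathlib

open MeasureTheory ProbabilityTheory

namespace EulerianMean

/-- The number of descents of a permutation `σ` of length `n`, i.e. of positions `i` having a
successor `i + 1` with `σ (i + 1) < σ i`. -/
def descents {n : ℕ} (σ : Equiv.Perm (Fin n)) : ℕ :=
  (Finset.univ.filter fun i : Fin n => ∃ h : (i : ℕ) + 1 < n, σ ⟨(i : ℕ) + 1, h⟩ < σ i).card

/-- The Eulerian number `⟨n, k⟩`: the number of permutations of length `n` with exactly `k`
descents. The index `k` is an integer, so that `⟨n, -1⟩ = 0`. -/
def eulerian (n : ℕ) (k : ℤ) : ℕ :=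
  (Finset.univ.filter fun σ : Equiv.Perm (Fin n) => (descents σ : ℤ) = k).card

/-- The sum of the first `m` of the numbers `x_1, …, x_n` (used with `m ≤ n`). -/
noncomputable def partialSum {n : ℕ} (x : Fin n → ℝ) (m : ℕ) : ℝ :=
  ∑ i ∈ Finset.univ.filter (fun i : Fin n => (i : ℕ) < m), x i

/-- The mean of `x_1, …, x_n`. -/
noncomputable def mean {n : ℕ} (x : Fin n → ℝ) : ℝ :=
  (∑ i : Fin n, x i) / n

/-- The number of the `x_1, …, x_n` that exceed their mean. -/
noncomputable def numAboveMean {n : ℕ} (x : Fin n → ℝ) : ℕ :=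
  (Finset.univ.filter fun i : Fin n => mean x < x i).card

end EulerianMean

/-! Everything is moved to the circle ℝ/ℤ, where surjective homomorphisms preserve the uniform law.
Sums: partial sums of uniform points are again independent uniform points, and the floor of the real
sum counts the wraps past 0, which are the descents of the representatives (`floor_sum_frac`).
Averaging over rearrangements makes the descents of independent uniforms Eulerian
(`volume_seqDescents_frac`). Mean: given the smallest variable, the others, translated and rescaled,
are `m = n - 1` fresh uniforms, so `W_n` becomes the number `N` of them above the mean of `0, w_1,
…, w_m`. Now place `m + 1` points on the circle and view the configuration from each in turn. A
cyclic shift by `r` matches the viewpoints with `N ≥ r` to those whose distance sum is `< m + 1 - r`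
(`card_le_rotNum`). Averaging over viewpoints gives `P(N ≥ r) = P(S_m < m + 1 - r)`, hence `P(N = k)
= P(⌊S_m⌋ = m - k)`, and Eulerian symmetry finishes. -/

namespace EulerianMean

/-! ### Uniform points on the circle -/

/-- The representative in `[0, 1)` of a point of the circle `ℝ / ℤ`. -/
noncomputable def frac (x : UnitAddCircle) : ℝ := (AddCircle.equivIco 1 0 x : ℝ)

lemma frac_coe (t : ℝ) : frac (t : UnitAddCircle) = Int.fract t := by
  have h : ((Int.fract t : ℝ) : UnitAddCircle) = (t : UnitAddCircle) := by
    rw [← sub_eq_zero, ← AddCircle.coe_sub, AddCircle.coe_eq_zero_iff]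
    exact ⟨-⌊t⌋, by rw [zsmul_one, Int.cast_neg]; linarith [Int.self_sub_floor t]⟩
  rw [frac, ← h, AddCircle.equivIco_coe_of_mem]
  simp [Int.fract_nonneg, Int.fract_lt_one]

lemma coe_frac (x : UnitAddCircle) : ((frac x : ℝ) : UnitAddCircle) = x :=
  AddCircle.coe_equivIco

lemma frac_nonneg (x : UnitAddCircle) : 0 ≤ frac x := (AddCircle.equivIco 1 0 x).2.1

lemma frac_lt_one (x : UnitAddCircle) : frac x < 1 :=
  (AddCircle.equivIco (1 : ℝ) 0 x).2.2.trans_eq (zero_add 1)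

@[simp] lemma frac_zero : frac 0 = 0 := by
  simpa using frac_coe 0

lemma frac_injective : Function.Injective frac := fun x y h => by
  rw [← coe_frac x, h, coe_frac]

lemma measurable_frac : Measurable frac :=
  measurable_subtype_coe.comp (AddCircle.measurableEquivIco 1 0).measurable

lemma measurable_frac_comp (ι : Type*) :
    Measurable fun (x : ι → UnitAddCircle) i => frac (x i) :=
  measurable_pi_iff.2 fun i => measurable_frac.comp (measurable_pi_apply i)

lemma measurePreserving_frac :
    MeasurePreserving frac volume (volume.restrict (Set.Icc (0 : ℝ) 1)) := by
  refine ⟨measurable_frac, ?_⟩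
  have h := UnitAddCircle.measurePreserving_mk 0
  rw [← h.map_eq, Measure.map_map measurable_frac h.measurable, zero_add,
    ← Measure.restrict_congr_set (Ioc_ae_eq_Icc (μ := volume) (a := (0 : ℝ)) (b := 1))]
  conv_rhs => rw [← Measure.map_id (μ := volume.restrict (Set.Ioc (0 : ℝ) 1))]
  refine Measure.map_congr ?_
  rw [← Measure.restrict_congr_set (Ioo_ae_eq_Ioc (μ := volume) (a := (0 : ℝ)) (b := 1))]
  filter_upwards [ae_restrict_mem measurableSet_Ioo] with t ht
  simp only [Function.comp, frac_coe, id]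
  exact Int.fract_eq_self.2 ⟨ht.1.le, ht.2⟩

/-- A surjective continuous homomorphism of compact groups carries Haar measure to Haar measure;
equal total mass fixes the constant. -/
lemma measurePreserving_of_surjective {ι κ : Type*} [Fintype ι] [Fintype κ]
    (f : (ι → UnitAddCircle) →+ (κ → UnitAddCircle)) (hf : Continuous f)
    (hs : Function.Surjective f) : MeasurePreserving f volume volume :=
  f.measurePreserving hf hs (by simp [volume_pi, Measure.pi_univ])

lemma volume_singleton_zero : volume ({0} : Set UnitAddCircle) = 0 := by
  have h := measurePreserving_frac.measure_preimage
    (measurableSet_singleton (0 : ℝ)).nullMeasurableSet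
  have h' : frac ⁻¹' {0} = {0} := by
    ext x
    exact ⟨fun hx => frac_injective (by simpa using hx), fun hx => by simp_all⟩
  rw [← h', h]
  simp

/-- For `i ≠ j` the difference of two coordinates is uniform on the circle, so it almost surely
misses 0. -/
lemma ae_injective (ι : Type*) [Fintype ι] :
    ∀ᵐ x : ι → UnitAddCircle, Function.Injective x := by
  classical
  have h : ∀ p : ι × ι, ∀ᵐ x : ι → UnitAddCircle, x p.1 = x p.2 → p.1 = p.2 := by
    rintro ⟨i, j⟩
    by_cases hij : i = j
    · simp [hij]
    let f : (ι → UnitAddCircle) →+ UnitAddCircle :=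
      Pi.evalAddMonoidHom (fun _ => UnitAddCircle) i - Pi.evalAddMonoidHom (fun _ => UnitAddCircle) j
    have hf : MeasurePreserving f volume volume :=
      f.measurePreserving (by simp only [f]; exact (continuous_apply i).sub (continuous_apply j))
        (fun y => ⟨Pi.single i y, by simp [f, Ne.symm hij]⟩)
        (by simp [volume_pi, Measure.pi_univ])
    have h0 : volume (f ⁻¹' {0}) = 0 := by
      rw [hf.measure_preimage (measurableSet_singleton _).nullMeasurableSet,
        volume_singleton_zero]
    refine (measure_eq_zero_iff_ae_notMem.1 h0).mono fun x hx hxx => absurd ?_ hx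
    simp [f, hxx]
  filter_upwards [ae_all_iff.2 h] with x hx i j hij using hx (i, j) hij

/-- Independent uniform variables on `[0, 1]` are distributed as the representatives of
independent uniform points of the circle. -/
lemma measure_eq_volume_frac {Ω ι : Type*} [Fintype ι] [MeasurableSpace Ω] {P : Measure Ω}
    [IsProbabilityMeasure P] {U : ι → Ω → ℝ} (hmeas : ∀ i, Measurable (U i))
    (hindep : iIndepFun U P)
    (hunif : ∀ i, pdf.IsUniform (U i) (Set.Icc (0 : ℝ) 1) P volume)
    {A : Set (ι → ℝ)} (hA : MeasurableSet A) :
    P {ω | (fun i => U i ω) ∈ A} = volume {x : ι → UnitAddCircle | (fun i => frac (x i)) ∈ A} := by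
  have h1 : P.map (fun ω i => U i ω) =
      Measure.pi fun _ => volume.restrict (Set.Icc (0 : ℝ) 1) := by
    rw [hindep.map_fun_eq_pi_map fun i => (hmeas i).aemeasurable]
    congr 1
    ext1 i
    rw [hunif i, ProbabilityTheory.cond]
    simp
  have h2 : MeasurePreserving (fun (x : ι → UnitAddCircle) i => frac (x i)) volume
      (Measure.pi fun _ => volume.restrict (Set.Icc (0 : ℝ) 1)) :=
    measurePreserving_pi _ _ fun _ => measurePreserving_frac
  have h3 := h2.measure_preimage hA.nullMeasurableSet
  rw [← h1, Measure.map_apply (measurable_pi_iff.2 hmeas) hA] at h3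
  exact h3.symm

/-! ### Descents and Eulerian numbers -/

open Classical in
/-- The number of descents of a finite sequence. -/
noncomputable def seqDescents {α : Type*} [LT α] {m : ℕ} (v : Fin m → α) : ℕ :=
  (Finset.univ.filter fun i : Fin m => ∃ h : (i : ℕ) + 1 < m, v ⟨(i : ℕ) + 1, h⟩ < v i).card

lemma descents_eq_seqDescents {m : ℕ} (σ : Equiv.Perm (Fin m)) : descents σ = seqDescents σ := by
  unfold descents seqDescents
  congr

lemma seqDescents_congr {α β : Type*} [LT α] [LT β] {m : ℕ} {v : Fin m → α} {w : Fin m → β}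
    (h : ∀ i j, v i < v j ↔ w i < w j) : seqDescents v = seqDescents w := by
  classical
  unfold seqDescents
  refine congrArg Finset.card (Finset.filter_congr fun i _ => ?_)
  simp only [h]

/-- Among the rearrangements of an injective sequence, the number of those with `k` descents is
an Eulerian number. -/
lemma card_perm_seqDescents_comp {m : ℕ} {v : Fin m → ℝ} (hv : Function.Injective v) (k : ℤ) :
    (Finset.univ.filter fun σ : Equiv.Perm (Fin m) => (seqDescents (v ∘ σ) : ℤ) = k).card =
      eulerian m k := by
  -- Only relative order matters: once `v` is sorted, rearranging it is the same as rearranging `Fin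
  -- m`.
  have hs : StrictMono (v ∘ Tuple.sort v) :=
    (Tuple.monotone_sort v).strictMono_of_injective (hv.comp (Tuple.sort v).injective)
  have h : ∀ σ : Equiv.Perm (Fin m),
      seqDescents (v ∘ (Tuple.sort v * σ : Equiv.Perm (Fin m))) = descents σ := fun σ => by
    rw [descents_eq_seqDescents]
    exact seqDescents_congr fun i j => hs.lt_iff_lt
  symm
  refine Finset.card_equiv (Equiv.mulLeft (Tuple.sort v)) fun σ => ?_
  simp only [Finset.mem_filter, Finset.mem_univ, true_and, Equiv.coe_mulLeft, h]

/-- Reversing the order of the values exchanges ascents and descents. -/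
lemma eulerian_symm {m : ℕ} (hm : 0 < m) (k : ℤ) : eulerian m (m - 1 - k) = eulerian m k := by
  have h : ∀ σ : Equiv.Perm (Fin m),
      descents σ + descents (Fin.revPerm * σ) = m - 1 := fun σ => by
    have hc : (Finset.univ.filter fun i : Fin m => (i : ℕ) + 1 < m).card = m - 1 := by
      obtain ⟨l, rfl⟩ : ∃ l, m = l + 1 := ⟨m - 1, by omega⟩
      have := Fin.card_filter_val_lt (n := l + 1) (m := l)
      simpa using this
    rw [← hc, descents, descents, ← Finset.card_union_of_disjoint]
    · congr 1
      ext i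
      simp only [Finset.mem_union, Finset.mem_filter, Finset.mem_univ, true_and,
        Equiv.Perm.mul_apply, Fin.revPerm_apply, Fin.rev_lt_rev]
      constructor
      · rintro (⟨h, -⟩ | ⟨h, -⟩) <;> exact h
      · intro h
        rcases lt_trichotomy (σ ⟨i + 1, h⟩) (σ i) with h' | h' | h'
        · exact .inl ⟨h, h'⟩
        · have := congrArg Fin.val (σ.injective h')
          simp at this
        · exact .inr ⟨h, h'⟩
    · rw [Finset.disjoint_filter]
      rintro i - ⟨h, h1⟩ ⟨_, h2⟩
      simp only [Equiv.Perm.mul_apply, Fin.revPerm_apply, Fin.rev_lt_rev] at h2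
      exact lt_asymm h1 h2
  refine Finset.card_equiv (Equiv.mulLeft Fin.revPerm) fun σ => ?_
  have := h σ
  simp only [Finset.mem_filter, Finset.mem_univ, true_and, Equiv.coe_mulLeft]
  omega

/-! ### Floors of sums as descent counts -/

/-- The sum of the first `k` terms of a finite sequence. -/
def psum {M : Type*} [AddCommMonoid M] {m : ℕ} (x : Fin m → M) (k : ℕ) : M :=
  ∑ i ∈ Finset.univ.filter (fun i : Fin m => (i : ℕ) < k), x i

section psum
variable {M : Type*} {m : ℕ}

@[simp] lemma psum_zero [AddCommMonoid M] (x : Fin m → M) : psum x 0 = 0 := by simp [psum]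

lemma psum_self [AddCommMonoid M] (x : Fin m → M) : psum x m = ∑ i, x i := by simp [psum]

lemma psum_succ [AddCommMonoid M] (x : Fin m → M) {k : ℕ} (hk : k < m) :
    psum x (k + 1) = psum x k + x ⟨k, hk⟩ := by
  have : (Finset.univ.filter fun i : Fin m => (i : ℕ) < k + 1) =
      insert ⟨k, hk⟩ (Finset.univ.filter fun i : Fin m => (i : ℕ) < k) := by
    ext i
    simp [Fin.ext_iff]
    omega
  rw [psum, this, Finset.sum_insert (by simp), add_comm, psum]

/-- The sequence of partial sums, as an additive homomorphism. -/
def psumHom (M : Type*) [AddCommMonoid M] (m : ℕ) : (Fin m → M) →+ (Fin m → M) where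
  toFun x i := psum x (i + 1)
  map_zero' := by ext; simp [psum]
  map_add' x y := by ext; simp [psum, Finset.sum_add_distrib]

lemma psumHom_surjective [AddCommGroup M] : Function.Surjective (psumHom M m) := by
  intro y
  -- The prescribed partial sums, shifted by one so that `z 0 = 0`; their increments form the
  -- preimage.
  let z : ℕ → M := fun k => if h : 0 < k ∧ k ≤ m then y ⟨k - 1, by omega⟩ else 0
  let x : Fin m → M := fun i => z (i + 1) - z i
  have h : ∀ k ≤ m, psum x k = z k := by
    intro k
    induction k with
    | zero => simp [z]
    | succ k ih =>
      intro hk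
      rw [psum_succ x hk, ih (by omega)]
      simp [x]
  refine ⟨x, funext fun i => ?_⟩
  change psum x (i + 1) = y i
  rw [h _ i.2]
  simp [z]

/-- A step in `[0, 1)` raises the floor by 0 or 1, and by 1 exactly when the fractional part drops.
-/
lemma floor_psum {u : Fin m → ℝ} (h0 : ∀ i, 0 ≤ u i) (h1 : ∀ i, u i < 1) {k : ℕ} (hk : k ≤ m) :
    ⌊psum u k⌋ = ((Finset.range k).filter fun i =>
      Int.fract (psum u (i + 1)) < Int.fract (psum u i)).card := by
  induction k with
  | zero => simp
  | succ k ih =>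
    rw [Finset.range_add_one, Finset.filter_insert]
    have ih := ih (by omega)
    have hs := psum_succ u hk
    have h0 := h0 ⟨k, hk⟩
    have h1 := h1 ⟨k, hk⟩
    set a := psum u k
    set b := psum u (k + 1)
    have ha0 := Int.fract_nonneg a
    have ha1 := Int.fract_lt_one a
    have ha := Int.floor_add_fract a
    by_cases hc : Int.fract a + u ⟨k, hk⟩ < 1
    · have hf : ⌊b⌋ = ⌊a⌋ := by
        rw [Int.floor_eq_iff]
        constructor <;> linarith
      have hb := Int.floor_add_fract b
      rw [hf] at hb
      rw [if_neg (by linarith), hf, ih]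
    · have hf : ⌊b⌋ = ⌊a⌋ + 1 := by
        rw [Int.floor_eq_iff]
        push_cast
        constructor <;> linarith
      have hb := Int.floor_add_fract b
      rw [hf] at hb
      push_cast at hb
      rw [if_pos (by linarith), Finset.card_insert_of_notMem (by simp), hf, ih]
      push_cast
      rfl

lemma floor_sum_eq_seqDescents {u : Fin m → ℝ} (h0 : ∀ i, 0 ≤ u i) (h1 : ∀ i, u i < 1) :
    ⌊∑ i, u i⌋ = seqDescents fun i : Fin m => Int.fract (psum u (i + 1)) := by
  rw [← psum_self, floor_psum h0 h1 le_rfl, Nat.cast_inj, seqDescents]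
  symm
  refine Finset.card_nbij (fun i => (i : ℕ) + 1) ?_ ?_ ?_
  · intro i hi
    simp only [Finset.coe_filter, Finset.mem_univ, true_and, Set.mem_ofPred_eq,
      Finset.mem_range] at hi ⊢
    obtain ⟨h, h'⟩ := hi
    exact ⟨h, h'⟩
  · intro i _ j _ hij
    exact Fin.ext (by simpa using hij)
  · intro i hi
    simp only [Finset.coe_filter, Finset.mem_range, Set.mem_ofPred_eq] at hi
    obtain ⟨h, h'⟩ := hi
    rcases i with _ | i
    -- No drop can start from the empty sum, whose fractional part is 0, so all drops are descents
    -- of the sequence.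
    · simp only [psum_zero, Int.fract_zero] at h'
      exact absurd h' (not_lt.2 (Int.fract_nonneg _))
    · exact ⟨⟨i, by omega⟩, by simpa using ⟨h, h'⟩, rfl⟩

end psum

lemma floor_sum_frac {m : ℕ} (x : Fin m → UnitAddCircle) :
    ⌊∑ i, frac (x i)⌋ = seqDescents fun i => frac (psumHom UnitAddCircle m x i) := by
  rw [floor_sum_eq_seqDescents (fun i => frac_nonneg _) fun i => frac_lt_one _]
  congr 2
  ext i
  rw [← frac_coe]
  congr 1
  change _ = psum x (i + 1)
  simp only [psum]
  rw [show ((∑ i ∈ Finset.univ.filter (fun j : Fin m => (j : ℕ) < i + 1), frac (x i) : ℝ) :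
    UnitAddCircle) = _ from map_sum (QuotientAddGroup.mk' (AddSubgroup.zmultiples (1 : ℝ))) _ _]
  exact Finset.sum_congr rfl fun j _ => coe_frac _

/-! ### Eulerian law of descents and of floors of sums -/

lemma measurable_seqDescents (m : ℕ) : Measurable fun v : Fin m → ℝ => seqDescents v := by
  classical
  simp only [seqDescents, Finset.card_filter]
  refine Finset.measurable_sum _ fun i _ => ?_
  refine Measurable.ite ?_ measurable_const measurable_const
  by_cases h : (i : ℕ) + 1 < m
  · simp only [h, exists_true_left]
    exact measurableSet_lt (measurable_pi_apply _) (measurable_pi_apply _)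
  · simp [h]

lemma measurableSet_seqDescents_frac (m : ℕ) (k : ℤ) :
    MeasurableSet {y : Fin m → UnitAddCircle |
      (seqDescents (fun i => frac (y i)) : ℤ) = k} := by
  have h := (measurable_seqDescents m).comp (measurable_frac_comp (Fin m))
  exact h (MeasurableSet.of_discrete (s := {d : ℕ | (d : ℤ) = k}))

lemma measurePreserving_comp_perm {m : ℕ} (σ : Equiv.Perm (Fin m)) :
    MeasurePreserving (fun x : Fin m → UnitAddCircle => x ∘ σ) volume volume := by
  let f : (Fin m → UnitAddCircle) →+ (Fin m → UnitAddCircle) :=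
    { toFun := fun x => x ∘ σ, map_zero' := rfl, map_add' := fun _ _ => rfl }
  refine measurePreserving_of_surjective f ?_ fun y => ⟨y ∘ σ.symm, ?_⟩
  · exact continuous_pi fun i => continuous_apply (σ i)
  · ext i; simp [f]

/-- The number of descents of independent uniform variables has the Eulerian distribution. -/
lemma volume_seqDescents_frac (m : ℕ) (k : ℤ) :
    volume {y : Fin m → UnitAddCircle | (seqDescents (fun i => frac (y i)) : ℤ) = k} =
      eulerian m k / Nat.factorial m := by
  classical
  set A := {y : Fin m → UnitAddCircle | (seqDescents (fun i => frac (y i)) : ℤ) = k} with hAdef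
  have hA : MeasurableSet A := measurableSet_seqDescents_frac m k
  have hσ : ∀ σ : Equiv.Perm (Fin m),
      ∫⁻ y : Fin m → UnitAddCircle, A.indicator 1 (y ∘ σ) = volume A := fun σ => by
    rw [(measurePreserving_comp_perm σ).lintegral_comp (measurable_one.indicator hA),
      lintegral_indicator_one hA]
  -- Integrate the number of `σ` for which `y ∘ σ` has `k` descents: it equals the Eulerian number
  -- for every injective `y`, hence almost surely.
  have hsum : ∑ σ : Equiv.Perm (Fin m), volume A = eulerian m k := by
    rw [← Finset.sum_congr rfl fun σ _ => hσ σ, ← lintegral_finsetSum]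
    · rw [lintegral_congr_ae (g := fun _ => (eulerian m k : ENNReal))]
      · simp [volume_pi, Measure.pi_univ]
      · filter_upwards [ae_injective (Fin m)] with y hy
        rw [← card_perm_seqDescents_comp (frac_injective.comp hy) k, Finset.card_filter]
        push_cast
        refine Finset.sum_congr rfl fun σ _ => ?_
        simp only [Set.indicator_apply, hAdef, Set.mem_ofPred_eq, Pi.one_apply]
        rfl
    · intro σ _
      exact (measurable_one.indicator hA).comp (measurePreserving_comp_perm σ).measurable
  rw [Finset.sum_const, Finset.card_univ, Fintype.card_perm, Fintype.card_fin, nsmul_eq_mul] at hsum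
  rw [ENNReal.eq_div_iff (by simp [Nat.factorial_ne_zero]) (by simp), hsum]

/-- The integer part of the sum of independent uniform variables has the Eulerian distribution. -/
lemma volume_floor_sum_frac (m : ℕ) (k : ℤ) :
    volume {x : Fin m → UnitAddCircle | ⌊∑ i, frac (x i)⌋ = k} =
      eulerian m k / Nat.factorial m := by
  rw [← volume_seqDescents_frac]
  have hc : Continuous (psumHom UnitAddCircle m) :=
    continuous_pi fun i => show Continuous fun x : Fin m → UnitAddCircle => psum x (i + 1) from
      continuous_finsetSum _ fun j _ => continuous_apply j
  have h := measurePreserving_of_surjective (psumHom UnitAddCircle m) hc psumHom_surjective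
  rw [← h.measure_preimage (measurableSet_seqDescents_frac m k).nullMeasurableSet]
  simp only [floor_sum_frac, Set.preimage_ofPred_eq]

/-! ### Cyclic duality -/

/-- The sum of the counterclockwise distances of the points of a configuration from its `j`-th point. -/
noncomputable def rotSum {m : ℕ} (x : Fin (m + 1) → UnitAddCircle) (j : Fin (m + 1)) : ℝ :=
  ∑ i, frac (x i - x j)

/-- The number of points of a configuration above its mean, seen from its `j`-th point. -/
noncomputable def rotNum {m : ℕ} (x : Fin (m + 1) → UnitAddCircle) (j : Fin (m + 1)) : ℕ :=
  (Finset.univ.filter fun i => rotSum x j / (m + 1) < frac (x i - x j)).card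

/-- The number of the `w_1, …, w_m` that exceed the mean of `0, w_1, …, w_m`. -/
noncomputable def numAboveMeanZero {m : ℕ} (w : Fin m → ℝ) : ℕ :=
  (Finset.univ.filter fun i => (∑ l, w l) / (m + 1) < w i).card

/-- The configuration of the other points seen from the `j`-th one. -/
def rotHom (m : ℕ) (j : Fin (m + 1)) :
    (Fin (m + 1) → UnitAddCircle) →+ (Fin m → UnitAddCircle) where
  toFun x i := x (j.succAbove i) - x j
  map_zero' := by ext; simp
  map_add' x y := by ext; simp; abel

lemma measurePreserving_rotHom (m : ℕ) (j : Fin (m + 1)) :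
    MeasurePreserving (rotHom m j) volume volume := by
  refine measurePreserving_of_surjective _ ?_ fun y => ⟨j.insertNth 0 y, ?_⟩
  · exact continuous_pi fun i => (continuous_apply (j.succAbove i)).sub (continuous_apply j)
  · ext i
    simp [rotHom]

lemma rotSum_eq {m : ℕ} (x : Fin (m + 1) → UnitAddCircle) (j : Fin (m + 1)) :
    rotSum x j = ∑ i, frac (rotHom m j x i) := by
  rw [rotSum, Fin.sum_univ_succAbove _ j]
  simp [rotHom]

lemma rotSum_nonneg {m : ℕ} (x : Fin (m + 1) → UnitAddCircle) (j : Fin (m + 1)) :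
    0 ≤ rotSum x j := Finset.sum_nonneg fun _ _ => frac_nonneg _

/-- The viewpoint itself is at distance 0 and never exceeds the mean, so it contributes only to the
denominator. -/
lemma rotNum_eq {m : ℕ} (x : Fin (m + 1) → UnitAddCircle) (j : Fin (m + 1)) :
    rotNum x j = numAboveMeanZero fun i => frac (rotHom m j x i) := by
  have h : ¬ rotSum x j / (m + 1) < frac (x j - x j) := by
    simpa using div_nonneg (rotSum_nonneg x j) (by positivity)
  rw [rotNum, numAboveMeanZero, Finset.card_filter, Finset.card_filter,
    Fin.sum_univ_succAbove _ j, if_neg h, zero_add, rotSum_eq]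
  rfl

lemma frac_sub (x y : UnitAddCircle) :
    frac (x - y) = frac x - frac y + if frac x < frac y then 1 else 0 := by
  have hx0 := frac_nonneg x
  have hx1 := frac_lt_one x
  have hy0 := frac_nonneg y
  have hy1 := frac_lt_one y
  have h : frac (x - y) = Int.fract (frac x - frac y) := by
    rw [← frac_coe, AddCircle.coe_sub, coe_frac, coe_frac]
  rw [h, Int.fract_eq_iff]
  split_ifs with hxy
  · exact ⟨by linarith, by linarith, -1, by push_cast; ring⟩
  · exact ⟨by linarith, by linarith, 0, by push_cast; ring⟩

section sorted
variable {m : ℕ} {x : Fin (m + 1) → UnitAddCircle}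

/-- In sorted order exactly the `j` points before the viewpoint wrap around, each gaining 1. -/
lemma rotSum_of_strictMono (hx : StrictMono fun i => frac (x i)) (j : Fin (m + 1)) :
    rotSum x j = ∑ i, frac (x i) - (m + 1) * frac (x j) + (j : ℕ) := by
  simp only [rotSum, frac_sub, hx.lt_iff_lt, Finset.sum_add_distrib, Finset.sum_sub_distrib,
    Finset.sum_boole, Finset.filter_gt_eq_Iio, Fin.card_Iio]
  simp

/-- `hij` says that `i` is `r` places before `j` cyclically, without or with passing the origin; so
`i` is the `r`-th farthest point seen from `j`. -/
lemma card_frac_sub_le (hx : StrictMono fun i => frac (x i)) {r : ℕ} (hr : 1 ≤ r)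
    (hrm : r ≤ m + 1) {i j : Fin (m + 1)}
    (hij : (r ≤ j ∧ (i : ℕ) + r = j) ∨ ((j : ℕ) < r ∧ (i : ℕ) + r = j + (m + 1))) :
    (Finset.univ.filter fun l => frac (x i - x j) ≤ frac (x l - x j)).card = r := by
  have h0 := fun l => frac_nonneg (x l)
  have h1 := fun l => frac_lt_one (x l)
  rcases hij with ⟨hrj, hij⟩ | ⟨hrj, hij⟩
  · have : (Finset.univ.filter fun l => frac (x i - x j) ≤ frac (x l - x j)) =
        Finset.Ico i j := by
      ext l
      simp only [Finset.mem_filter, Finset.mem_univ, true_and, Finset.mem_Ico, frac_sub,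
        hx.lt_iff_lt]
      rw [if_pos (Fin.lt_def.2 (by omega))]
      by_cases hl : l < j
      · simp only [hl, if_true, and_true]
        rw [← hx.le_iff_le]
        constructor <;> intro h <;> linarith
      · simp only [hl, if_false, and_false, iff_false]
        linarith [h0 i, h1 l]
    rw [this, Fin.card_Ico]
    omega
  · have : (Finset.univ.filter fun l => frac (x i - x j) ≤ frac (x l - x j)) =
        Finset.Ici i ∪ Finset.Iio j := by
      ext l
      simp only [Finset.mem_filter, Finset.mem_univ, true_and, Finset.mem_union, Finset.mem_Ici,
        Finset.mem_Iio, frac_sub, hx.lt_iff_lt]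
      rw [if_neg (by rw [Fin.lt_def]; omega)]
      by_cases hl : l < j
      · simp only [hl, if_true, or_true, iff_true]
        linarith [h0 l, h1 i]
      · simp only [hl, if_false, or_false]
        rw [← hx.le_iff_le]
        constructor <;> intro h <;> linarith
    rw [this, Finset.card_union_of_disjoint, Fin.card_Ici, Fin.card_Iio]
    · omega
    · rw [Finset.disjoint_left]
      intro l hl hl'
      rw [Finset.mem_Ici, Fin.le_def] at hl
      rw [Finset.mem_Iio, Fin.lt_def] at hl'
      omega

/-- At least `r` points exceed the mean iff the `r`-th farthest one, `i`, does. In the formula for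
`rotSum` the terms in `x j` cancel, leaving a condition on the sum seen from `i`. -/
lemma le_rotNum_iff (hx : StrictMono fun i => frac (x i)) {r : ℕ} (hr : 1 ≤ r)
    (hrm : r ≤ m + 1) {i j : Fin (m + 1)}
    (hij : (r ≤ j ∧ (i : ℕ) + r = j) ∨ ((j : ℕ) < r ∧ (i : ℕ) + r = j + (m + 1))) :
    r ≤ rotNum x j ↔ rotSum x i < (m + 1 : ℝ) - r := by
  have hcard := card_frac_sub_le hx hr hrm hij
  have h1 : r ≤ rotNum x j ↔ rotSum x j / (m + 1) < frac (x i - x j) := by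
    constructor
    · intro h
      by_contra hc
      -- If `i` is not above the mean, the points above it form a proper subset of the `r` points at
      -- least as far as `i`.
      refine absurd h (not_le.2 ?_)
      rw [← hcard, rotNum]
      refine Finset.card_lt_card (Finset.ssubset_iff_of_subset ?_ |>.2 ⟨i, by simp, ?_⟩)
      · intro l
        simp only [Finset.mem_filter, Finset.mem_univ, true_and]
        intro hl
        exact ((not_lt.1 hc).trans_lt hl).le
      · simpa using hc
    · intro h
      rw [← hcard]
      refine Finset.card_le_card fun l => ?_
      simp only [Finset.mem_filter, Finset.mem_univ, true_and]
      exact fun hl => h.trans_le hl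
  rw [h1, div_lt_iff₀ (by positivity), rotSum_of_strictMono hx, rotSum_of_strictMono hx, frac_sub]
  simp only [hx.lt_iff_lt]
  rcases hij with ⟨hrj, hij⟩ | ⟨hrj, hij⟩
  · rw [if_pos (Fin.lt_def.2 (by omega))]
    have : (i : ℝ) + r = j := by exact_mod_cast hij
    constructor <;> intro h <;> linarith
  · rw [if_neg (by rw [Fin.lt_def]; omega)]
    have : (i : ℝ) + r = j + (m + 1) := by exact_mod_cast hij
    constructor <;> intro h <;> linarith

lemma card_le_rotNum_of_strictMono (hx : StrictMono fun i => frac (x i)) {r : ℕ} (hr : 1 ≤ r)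
    (hrm : r ≤ m + 1) :
    (Finset.univ.filter fun j => r ≤ rotNum x j).card =
      (Finset.univ.filter fun j => rotSum x j < (m + 1 : ℝ) - r).card := by
  refine Finset.card_equiv (Equiv.subRight (Fin.ofNat (m + 1) r)) fun j => ?_
  simp only [Finset.mem_filter, Finset.mem_univ, true_and, Equiv.subRight_apply]
  refine le_rotNum_iff hx hr hrm ?_
  rw [Fin.val_sub, Fin.val_ofNat]
  have hj := j.2
  -- For `r = m + 1` the shift is 0 in `Fin (m + 1)`: a full turn, with `i = j`.
  rcases hrm.eq_or_lt with rfl | hrm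
  · right
    simp only [Nat.mod_self]
    rw [Nat.sub_zero, Nat.add_mod_left, Nat.mod_eq_of_lt hj]
    omega
  · rw [Nat.mod_eq_of_lt hrm]
    by_cases h : r ≤ j
    · left
      rw [show m + 1 - r + (j : ℕ) = (j - r) + (m + 1) by omega, Nat.add_mod_right,
        Nat.mod_eq_of_lt (by omega)]
      omega
    · right
      rw [Nat.mod_eq_of_lt (by omega)]
      omega

end sorted

lemma rotSum_comp_perm {m : ℕ} (x : Fin (m + 1) → UnitAddCircle) (σ : Equiv.Perm (Fin (m + 1)))
    (j : Fin (m + 1)) : rotSum (x ∘ σ) j = rotSum x (σ j) :=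
  Equiv.sum_comp σ fun i => frac (x i - x (σ j))

lemma rotNum_comp_perm {m : ℕ} (x : Fin (m + 1) → UnitAddCircle) (σ : Equiv.Perm (Fin (m + 1)))
    (j : Fin (m + 1)) : rotNum (x ∘ σ) j = rotNum x (σ j) := by
  simp only [rotNum, rotSum_comp_perm]
  exact Finset.card_equiv σ fun i => by simp

/-- For any configuration of distinct points on the circle, the number above the mean and the sum
of the distances, seen from each of the points in turn, are in duality. -/
lemma card_le_rotNum {m : ℕ} {x : Fin (m + 1) → UnitAddCircle} (hx : Function.Injective x)
    (r : ℕ) :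
    (Finset.univ.filter fun j => r ≤ rotNum x j).card =
      (Finset.univ.filter fun j => rotSum x j < (m + 1 : ℝ) - r).card := by
  rcases Nat.eq_zero_or_pos r with rfl | hr
  -- For `r = 0` both conditions always hold, since all distances are below 1.
  · congr 1
    refine Finset.filter_congr fun j _ => ?_
    have : rotSum x j < ∑ i : Fin (m + 1), (1 : ℝ) :=
      Finset.sum_lt_sum_of_nonempty Finset.univ_nonempty fun i _ => frac_lt_one _
    simp only [Finset.sum_const, Finset.card_univ, Fintype.card_fin, nsmul_eq_mul, mul_one] at this
    push_cast at this
    simpa using this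
  by_cases hrm : r ≤ m + 1
  · let f : Fin (m + 1) → ℝ := fun i => frac (x i)
    let σ := Tuple.sort f
    have hs : StrictMono fun i => frac ((x ∘ σ) i) :=
      (Tuple.monotone_sort f).strictMono_of_injective
        ((frac_injective.comp hx).comp σ.injective)
    have h := card_le_rotNum_of_strictMono hs hr hrm
    simp only [rotNum_comp_perm, rotSum_comp_perm] at h
    rw [← Finset.card_equiv σ (s := Finset.univ.filter fun j => r ≤ rotNum x (σ j))
      (fun i => by simp), h]
    exact Finset.card_equiv σ fun i => by simp
  · push Not at hrm
    rw [Finset.filter_false_of_mem, Finset.filter_false_of_mem]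
    · intro j _
      have : ((m + 1 : ℕ) : ℝ) < r := by exact_mod_cast hrm
      push_cast at this
      linarith [rotSum_nonneg x j]
    · intro j _
      have : rotNum x j ≤ m + 1 := (Finset.card_le_univ _).trans (by simp)
      omega

/-! ### Averaging the duality over viewpoints -/

lemma measurable_numAboveMeanZero (m : ℕ) :
    Measurable fun w : Fin m → ℝ => numAboveMeanZero w := by
  simp only [numAboveMeanZero, Finset.card_filter]
  refine Finset.measurable_sum _ fun i _ => ?_
  refine Measurable.ite (measurableSet_lt ?_ (measurable_pi_apply _)) measurable_const
    measurable_const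
  exact (Finset.measurable_sum _ fun i _ => measurable_pi_apply i).div_const _

lemma measurable_sum_frac (m : ℕ) : Measurable fun x : Fin m → UnitAddCircle => ∑ i, frac (x i) :=
  Finset.measurable_sum _ fun i _ => measurable_frac.comp (measurable_pi_apply i)

lemma volume_le_numAboveMeanZero (m r : ℕ) :
    volume {w : Fin m → UnitAddCircle | r ≤ numAboveMeanZero fun i => frac (w i)} =
      volume {w : Fin m → UnitAddCircle | ∑ i, frac (w i) < (m + 1 : ℝ) - r} := by
  set A := {w : Fin m → UnitAddCircle | r ≤ numAboveMeanZero fun i => frac (w i)} with hAdef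
  set B := {w : Fin m → UnitAddCircle | ∑ i, frac (w i) < (m + 1 : ℝ) - r} with hBdef
  have hA : MeasurableSet A :=
    ((measurable_numAboveMeanZero m).comp (measurable_frac_comp _))
      (MeasurableSet.of_discrete (s := {d : ℕ | r ≤ d}))
  have hB : MeasurableSet B := measurableSet_lt (measurable_sum_frac m) measurable_const
  -- From every viewpoint the other points are independent and uniform, so each of the `m + 1` terms
  -- integrates to `volume C`.
  have key : ∀ C : Set (Fin m → UnitAddCircle), MeasurableSet C →
      (m + 1 : ENNReal) * volume C =
        ∫⁻ x : Fin (m + 1) → UnitAddCircle, ∑ j, C.indicator 1 (rotHom m j x) := by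
    intro C hC
    rw [lintegral_finsetSum]
    · rw [Finset.sum_congr rfl fun j _ =>
        (measurePreserving_rotHom m j).lintegral_comp (measurable_one.indicator hC)]
      simp [lintegral_indicator_one hC]
    · exact fun j _ => (measurable_one.indicator hC).comp (measurePreserving_rotHom m j).measurable
  have h : (m + 1 : ENNReal) * volume A = (m + 1 : ENNReal) * volume B := by
    rw [key A hA, key B hB]
    refine lintegral_congr_ae ?_
    filter_upwards [ae_injective (Fin (m + 1))] with x hx
    have h := card_le_rotNum hx r
    rw [Finset.card_filter, Finset.card_filter] at h
    have h := congrArg (Nat.cast (R := ENNReal)) h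
    push_cast at h
    simp only [rotNum_eq, rotSum_eq] at h
    classical
    simp only [Set.indicator_apply, hAdef, hBdef, Set.mem_ofPred_eq, Pi.one_apply]
    exact h
  refine (ENNReal.mul_right_inj (by simp) ?_).1 h
  exact_mod_cast ENNReal.natCast_ne_top (m + 1)

/-- The number of independent uniform variables exceeding the mean of these variables and `0` has
the Eulerian distribution. -/
lemma volume_numAboveMeanZero {m : ℕ} (hm : 0 < m) (k : ℕ) :
    volume {w : Fin m → UnitAddCircle | numAboveMeanZero (fun i => frac (w i)) = k} =
      eulerian m (k - 1) / Nat.factorial m := by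
  have hN := (measurable_numAboveMeanZero m).comp (measurable_frac_comp (Fin m))
  have h1 : {w : Fin m → UnitAddCircle | numAboveMeanZero (fun i => frac (w i)) = k} =
      {w | k ≤ numAboveMeanZero fun i => frac (w i)} \
        {w | k + 1 ≤ numAboveMeanZero fun i => frac (w i)} := by
    ext w
    simp only [Set.mem_ofPred_eq, Set.mem_sdiff]
    omega
  have h2 : {w : Fin m → UnitAddCircle | ⌊∑ i, frac (w i)⌋ = m - k} =
      {w | ∑ i, frac (w i) < (m + 1 : ℝ) - k} \
        {w | ∑ i, frac (w i) < (m + 1 : ℝ) - (k + 1 : ℕ)} := by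
    ext w
    simp only [Set.mem_ofPred_eq, Set.mem_sdiff, Int.floor_eq_iff]
    push_cast
    constructor
    · rintro ⟨h, h'⟩
      constructor <;> linarith
    · rintro ⟨h, h'⟩
      constructor <;> linarith
  rw [← eulerian_symm hm, show (m : ℤ) - 1 - (k - 1) = m - k by ring, ← volume_floor_sum_frac,
    h1, h2, measure_sdiff, measure_sdiff, volume_le_numAboveMeanZero, volume_le_numAboveMeanZero]
  · intro w
    simp only [Set.mem_ofPred_eq]
    push_cast
    intro h
    linarith
  · exact (measurableSet_lt (measurable_sum_frac m) measurable_const).nullMeasurableSet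
  · exact measure_ne_top _ _
  · intro w
    simp only [Set.mem_ofPred_eq]
    omega
  · exact (hN (MeasurableSet.of_discrete (s := {d : ℕ | k + 1 ≤ d}))).nullMeasurableSet
  · exact measure_ne_top _ _

/-! ### Conditioning on the smallest variable -/

lemma numAboveMeanZero_smul {m : ℕ} {r : ℝ} (hr : 0 < r) (w : Fin m → ℝ) :
    numAboveMeanZero (fun i => r * w i) = numAboveMeanZero w := by
  simp only [numAboveMeanZero, ← Finset.mul_sum, mul_div_assoc, mul_lt_mul_iff_right₀ hr]

lemma numAboveMean_insertNth {m : ℕ} (p : Fin (m + 1)) {a : ℝ} {v : Fin m → ℝ}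
    (hv : ∀ i, a < v i) :
    numAboveMean (p.insertNth a v : Fin (m + 1) → ℝ) = numAboveMeanZero fun i => v i - a := by
  have hmean : mean (p.insertNth a v : Fin (m + 1) → ℝ) = a + (∑ i, (v i - a)) / (m + 1) := by
    rw [mean, Fin.sum_univ_succAbove _ p]
    simp only [Fin.insertNth_apply_same, Fin.insertNth_apply_succAbove, Finset.sum_sub_distrib,
      Finset.sum_const, Finset.card_univ, Fintype.card_fin, nsmul_eq_mul]
    push_cast
    field_simp
    ring
  have h0 : 0 ≤ (∑ i, (v i - a)) / (m + 1) :=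
    div_nonneg (Finset.sum_nonneg fun i _ => sub_nonneg.2 (hv i).le) (by positivity)
  rw [numAboveMean, numAboveMeanZero, Finset.card_filter, Finset.card_filter,
    Fin.sum_univ_succAbove _ p, hmean]
  simp only [Fin.insertNth_apply_same, Fin.insertNth_apply_succAbove]
  rw [if_neg (by linarith), zero_add]
  simp only [lt_sub_iff_add_lt']

lemma measurable_numAboveMean (n : ℕ) : Measurable fun x : Fin n → ℝ => numAboveMean x := by
  simp only [numAboveMean, Finset.card_filter]
  refine Finset.measurable_sum _ fun i _ => ?_
  refine Measurable.ite (measurableSet_lt ?_ (measurable_pi_apply _)) measurable_const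
    measurable_const
  exact (Finset.measurable_sum _ fun i _ => measurable_pi_apply i).div_const _

lemma measurableSet_min_and_numAboveMean {m : ℕ} (p : Fin (m + 1)) (k : ℕ) :
    MeasurableSet {x : Fin (m + 1) → ℝ |
      (∀ i, x p < x (p.succAbove i)) ∧ numAboveMean x = k} := by
  have h : {x : Fin (m + 1) → ℝ | (∀ i, x p < x (p.succAbove i)) ∧ numAboveMean x = k} =
      (⋂ i, {x | x p < x (p.succAbove i)}) ∩ numAboveMean ⁻¹' {k} := by
    ext x
    simp
  rw [h]
  refine MeasurableSet.inter (MeasurableSet.iInter fun i => ?_) ?_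
  · exact measurableSet_lt (measurable_pi_apply _) (measurable_pi_apply _)
  · exact measurable_numAboveMean _ (measurableSet_singleton k)

/-- The law of `m` independent uniform variables. -/
noncomputable def cubeMeasure (m : ℕ) : Measure (Fin m → ℝ) :=
  Measure.pi fun _ => volume.restrict (Set.Ioc (0 : ℝ) 1)

lemma cubeMeasure_eq (m : ℕ) :
    cubeMeasure m = volume.restrict (Set.univ.pi fun _ => Set.Ioc (0 : ℝ) 1) := by
  rw [cubeMeasure, volume_pi, Measure.restrict_pi_pi]

lemma measurePreserving_frac_comp (m : ℕ) :
    MeasurePreserving (fun (x : Fin m → UnitAddCircle) i => frac (x i)) volume (cubeMeasure m) := by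
  refine measurePreserving_pi _ _ fun _ => ?_
  rw [Measure.restrict_congr_set (Ioc_ae_eq_Icc (μ := volume) (a := (0 : ℝ)) (b := 1))]
  exact measurePreserving_frac

/-- The homothety with centre `(1, …, 1)` and ratio `1 - a` maps `(0, 1]^m` onto `(a, 1]^m`, and
scaling does not affect the count. The half-open cube turns `0 < w i` into exactly `a < v i`. -/
lemma cubeMeasure_numAboveMeanZero_sub {m : ℕ} (k : ℕ) {a : ℝ} (ha : a ∈ Set.Ioo (0 : ℝ) 1) :
    cubeMeasure m {v | (∀ i, a < v i) ∧ numAboveMeanZero (fun i => v i - a) = k} =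
      ENNReal.ofReal ((1 - a) ^ m) * cubeMeasure m {w | numAboveMeanZero w = k} := by
  have hr : 0 < 1 - a := by linarith [ha.2]
  have hbox : MeasurableSet (Set.univ.pi fun _ : Fin m => Set.Ioc (0 : ℝ) 1) :=
    MeasurableSet.univ_pi fun _ => measurableSet_Ioc
  rw [cubeMeasure_eq, Measure.restrict_apply' hbox, Measure.restrict_apply' hbox]
  have h := Measure.addHaar_image_homothety (volume : Measure (Fin m → ℝ)) (fun _ => 1) (1 - a)
    ({w | numAboveMeanZero w = k} ∩ Set.univ.pi fun _ => Set.Ioc (0 : ℝ) 1)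
  rw [Module.finrank_fin_fun, abs_of_pos (pow_pos hr m)] at h
  rw [← h]
  congr 1
  ext v
  simp only [Set.mem_inter_iff, Set.mem_ofPred_eq, Set.mem_univ_pi, Set.mem_Ioc, Set.mem_image]
  constructor
  · rintro ⟨⟨hv, hk⟩, hb⟩
    refine ⟨fun i => (1 - a)⁻¹ * (v i - a), ⟨?_, fun i => ⟨?_, ?_⟩⟩, ?_⟩
    · rw [numAboveMeanZero_smul (inv_pos.2 hr), hk]
    · exact mul_pos (inv_pos.2 hr) (sub_pos.2 (hv i))
    · rw [inv_mul_le_iff₀ hr]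
      linarith [(hb i).2]
    · ext i
      simp only [AffineMap.homothety_apply, vsub_eq_sub, vadd_eq_add, Pi.add_apply, Pi.smul_apply,
        Pi.sub_apply, smul_eq_mul]
      field_simp
      ring
  · rintro ⟨w, ⟨hk, hb⟩, rfl⟩
    have hw : ∀ i, AffineMap.homothety (fun _ => (1 : ℝ)) (1 - a) w i = (1 - a) * w i + a := by
      intro i
      simp only [AffineMap.homothety_apply, vsub_eq_sub, vadd_eq_add, Pi.add_apply, Pi.smul_apply,
        Pi.sub_apply, smul_eq_mul]
      ring
    simp only [hw, add_sub_cancel_right, numAboveMeanZero_smul hr]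
    have hpos := fun i => mul_pos hr (hb i).1
    have hle := fun i => mul_le_mul_of_nonneg_left (hb i).2 hr.le
    exact ⟨⟨fun i => by linarith [hpos i], hk⟩,
      fun i => ⟨by linarith [hpos i, ha.1], by linarith [hle i]⟩⟩

lemma lintegral_one_sub_pow (m : ℕ) :
    ∫⁻ a in Set.Ioc (0 : ℝ) 1, ENNReal.ofReal ((1 - a) ^ m) = ((m + 1 : ℕ) : ENNReal)⁻¹ := by
  have hc : Continuous fun a : ℝ => (1 - a) ^ m := by fun_prop
  rw [← ofReal_integral_eq_lintegral_ofReal]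
  · rw [← intervalIntegral.integral_of_le zero_le_one,
      intervalIntegral.integral_comp_sub_left (fun t : ℝ => t ^ m)]
    simp only [sub_self, sub_zero, integral_pow, one_pow, ne_eq, Nat.succ_ne_zero,
      not_false_eq_true, zero_pow, one_div]
    rw [ENNReal.ofReal_inv_of_pos (by positivity)]
    congr 1
    exact_mod_cast ENNReal.ofReal_natCast (m + 1)
  · exact (hc.integrableOn_Icc).mono_set Set.Ioc_subset_Icc_self
  · filter_upwards [ae_restrict_mem measurableSet_Ioc] with a ha
    exact pow_nonneg (by linarith [ha.2]) m

/-- Conditionally on a given variable being the smallest one, the number of variables above the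
mean does not depend on the value of the smallest one. -/
lemma cubeMeasure_numAboveMean_of_min {m : ℕ} (p : Fin (m + 1)) (k : ℕ) :
    cubeMeasure (m + 1) {x | (∀ i, x p < x (p.succAbove i)) ∧ numAboveMean x = k} =
      ((m + 1 : ℕ) : ENNReal)⁻¹ * cubeMeasure m {w | numAboveMeanZero w = k} := by
  set E : Set (Fin (m + 1) → ℝ) := {x | (∀ i, x p < x (p.succAbove i)) ∧ numAboveMean x = k}
    with hE
  have hEm : MeasurableSet E := measurableSet_min_and_numAboveMean p k
  -- Fubini with coordinate `p` split off: the slice at `x p = a` has measure `(1 - a)^m` times a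
  -- factor independent of `a`.
  have hmp := (measurePreserving_piFinSuccAbove
    (fun _ : Fin (m + 1) => volume.restrict (Set.Ioc (0 : ℝ) 1)) p).symm
  rw [cubeMeasure, ← hmp.measure_preimage hEm.nullMeasurableSet,
    Measure.prod_apply (hmp.measurable hEm)]
  have hae : ∀ᵐ a ∂(volume.restrict (Set.Ioc (0 : ℝ) 1)), a ∈ Set.Ioo (0 : ℝ) 1 := by
    rw [← Measure.restrict_congr_set (Ioo_ae_eq_Ioc (μ := volume) (a := (0 : ℝ)) (b := 1))]
    exact ae_restrict_mem measurableSet_Ioo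
  rw [lintegral_congr_ae (g := fun a => ENNReal.ofReal ((1 - a) ^ m) *
    cubeMeasure m {w | numAboveMeanZero w = k})]
  · rw [lintegral_mul_const _ (by fun_prop), lintegral_one_sub_pow]
  · filter_upwards [hae] with a ha
    rw [← cubeMeasure_numAboveMeanZero_sub k ha, cubeMeasure]
    congr 1
    ext v
    have : (MeasurableEquiv.piFinSuccAbove (fun _ => ℝ) p).symm (a, v) = p.insertNth a v := rfl
    simp only [Set.mem_preimage, this, hE, Set.mem_ofPred_eq, Fin.insertNth_apply_same,
      Fin.insertNth_apply_succAbove]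
    refine and_congr_right fun hv => ?_
    rw [numAboveMean_insertNth p hv]

lemma existsUnique_min {m : ℕ} {u : Fin (m + 1) → ℝ} (hu : Function.Injective u) :
    ∃! p, ∀ i, u p < u (p.succAbove i) := by
  obtain ⟨p, -, hp⟩ := Finset.exists_min_image Finset.univ u Finset.univ_nonempty
  refine ⟨p, fun i => lt_of_le_of_ne (hp _ (Finset.mem_univ _)) fun h =>
    Fin.succAbove_ne p i (hu h).symm, fun q hq => ?_⟩
  by_contra hpq
  obtain ⟨i, rfl⟩ := Fin.exists_succAbove_eq (Ne.symm hpq)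
  exact absurd (hq i) (not_lt.2 (hp _ (Finset.mem_univ _)))

/-- The number of independent uniform variables exceeding their mean has a shifted Eulerian
distribution. -/
lemma volume_numAboveMean {m : ℕ} (hm : 0 < m) (k : ℕ) :
    volume {x : Fin (m + 1) → UnitAddCircle | numAboveMean (fun i => frac (x i)) = k} =
      eulerian m (k - 1) / Nat.factorial m := by
  set A : Fin (m + 1) → Set (Fin (m + 1) → ℝ) := fun p =>
    {x | (∀ i, x p < x (p.succAbove i)) ∧ numAboveMean x = k} with hAdef
  have hA : ∀ p, MeasurableSet (A p) := fun p => measurableSet_min_and_numAboveMean p k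
  have hB : MeasurableSet {w : Fin m → ℝ | numAboveMeanZero w = k} :=
    measurable_numAboveMeanZero m (measurableSet_singleton k)
  have hp : ∀ p, volume ((fun (x : Fin (m + 1) → UnitAddCircle) i => frac (x i)) ⁻¹' A p) =
      ((m + 1 : ℕ) : ENNReal)⁻¹ * (eulerian m (k - 1) / Nat.factorial m) := fun p => by
    rw [(measurePreserving_frac_comp (m + 1)).measure_preimage (hA p).nullMeasurableSet,
      cubeMeasure_numAboveMean_of_min, ← volume_numAboveMeanZero hm,
      ← (measurePreserving_frac_comp m).measure_preimage hB.nullMeasurableSet]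
    rfl
  -- Almost surely exactly one coordinate is the minimum, so the event splits into `m + 1` disjoint
  -- pieces of equal measure.
  have hae : {x : Fin (m + 1) → UnitAddCircle | numAboveMean (fun i => frac (x i)) = k} =ᵐ[volume]
      ⋃ p, (fun (x : Fin (m + 1) → UnitAddCircle) i => frac (x i)) ⁻¹' A p := by
    rw [Filter.eventuallyEq_set]
    filter_upwards [ae_injective (Fin (m + 1))] with x hx
    simp only [Set.mem_iUnion, Set.mem_preimage, hAdef, Set.mem_ofPred_eq, exists_and_right]
    exact ⟨fun h => ⟨(existsUnique_min (frac_injective.comp hx)).exists, h⟩, fun h => h.2⟩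
  rw [measure_congr hae, measure_iUnion₀]
  · rw [tsum_fintype, Finset.sum_congr rfl fun p _ => hp p, Finset.sum_const, Finset.card_univ,
      Fintype.card_fin, nsmul_eq_mul, ← mul_assoc, ENNReal.mul_inv_cancel, one_mul]
    · exact Nat.cast_ne_zero.2 (Nat.succ_ne_zero m)
    · exact ENNReal.natCast_ne_top _
  · intro p q hpq
    refine Disjoint.aedisjoint (Set.disjoint_left.2 fun x hxp hxq => hpq ?_)
    by_contra hne
    obtain ⟨i, hi⟩ := Fin.exists_succAbove_eq (Ne.symm hne)
    obtain ⟨j, hj⟩ := Fin.exists_succAbove_eq hne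
    have h1 := hxp.1 i
    have h2 := hxq.1 j
    rw [hi] at h1
    rw [hj] at h2
    exact lt_asymm h1 h2
  · exact fun p => ((measurable_frac_comp _) (hA p)).nullMeasurableSet

end EulerianMean

/-! ### Transfer to the given random variables -/

theorem theorem1 {Ω : Type*} [MeasurableSpace Ω] (P : Measure Ω) [IsProbabilityMeasure P]
    (n : ℕ) (hn : 2 ≤ n) (U : Fin n → Ω → ℝ)
    (hmeas : ∀ i, Measurable (U i))
    (hindep : iIndepFun U P)
    (hunif : ∀ i, pdf.IsUniform (U i) (Set.Icc (0 : ℝ) 1) P volume) :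
    (∀ k : ℕ, P.real {ω | EulerianMean.numAboveMean (fun i => U i ω) = k} =
        (EulerianMean.eulerian (n - 1) ((k : ℤ) - 1) : ℝ) / (Nat.factorial (n - 1) : ℝ)) ∧
      IdentDistrib (fun ω => (EulerianMean.numAboveMean (fun i => U i ω) : ℤ) - 1)
        (fun ω => ⌊EulerianMean.partialSum (fun i => U i ω) (n - 1)⌋) P P ∧
      (∀ m : ℕ, m ≤ n → ∀ k : ℕ,
        P.real {ω | ⌊EulerianMean.partialSum (fun i => U i ω) m⌋ = (k : ℤ)} =
          (EulerianMean.eulerian m (k : ℤ) : ℝ) / (Nat.factorial m : ℝ)) := by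
  open EulerianMean in
  have hW : ∀ k : ℕ, P {ω | numAboveMean (fun i => U i ω) = k} =
      eulerian (n - 1) ((k : ℤ) - 1) / Nat.factorial (n - 1) := by
    intro k
    obtain ⟨m, rfl⟩ : ∃ m, n = m + 1 := ⟨n - 1, by omega⟩
    rw [Nat.add_sub_cancel, ← volume_numAboveMean (by omega)]
    exact measure_eq_volume_frac hmeas hindep hunif
      (measurable_numAboveMean _ (measurableSet_singleton k))
  have hS : ∀ m : ℕ, m ≤ n → ∀ k : ℤ, P {ω | ⌊partialSum (fun i => U i ω) m⌋ = k} =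
      eulerian m k / Nat.factorial m := by
    intro m hm k
    have hsum : ∀ ω, partialSum (fun i => U i ω) m = ∑ i : Fin m, U (Fin.castLE hm i) ω := by
      intro ω
      rw [partialSum]
      symm
      refine Finset.sum_bij (fun i _ => Fin.castLE hm i) ?_ ?_ ?_ ?_
      · intro i _
        simp
      · intro i _ j _ h
        exact Fin.castLE_injective hm h
      · intro i hi
        exact ⟨⟨i, by simpa using hi⟩, Finset.mem_univ _, rfl⟩
      · exact fun _ _ => rfl
    simp only [hsum]
    rw [← volume_floor_sum_frac]
    refine measure_eq_volume_frac (U := fun i => U (Fin.castLE hm i)) (fun i => hmeas _)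
      (hindep.precomp (Fin.castLE_injective hm)) (fun i => hunif _)
      (A := {u | ⌊∑ i, u i⌋ = k}) ?_
    exact (Int.measurable_floor.comp (Finset.measurable_sum _ fun i _ => measurable_pi_apply i))
      (measurableSet_singleton k)
  have hmU : Measurable fun ω i => U i ω := measurable_pi_iff.2 hmeas
  have hm1 : Measurable fun ω => (numAboveMean (fun i => U i ω) : ℤ) - 1 :=
    (measurable_from_top (f := fun d : ℕ => (d : ℤ) - 1)).comp
      ((measurable_numAboveMean n).comp hmU)
  have hm2 : Measurable fun ω => ⌊partialSum (fun i => U i ω) (n - 1)⌋ :=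
    Int.measurable_floor.comp (Finset.measurable_sum _ fun i _ => hmeas i)
  refine ⟨fun k => ?_, ⟨hm1.aemeasurable, hm2.aemeasurable, ?_⟩, fun m hm k => ?_⟩
  · simp [Measure.real, hW]
  · refine Measure.ext_of_singleton fun z => ?_
    rw [Measure.map_apply hm1 (measurableSet_singleton z),
      Measure.map_apply hm2 (measurableSet_singleton z)]
    refine Eq.trans ?_ (hS (n - 1) (by omega) z).symm
    -- Values `z ≥ -1` are `k - 1` for a natural `k`; below that, both probabilities vanish.
    by_cases hz : 0 ≤ z + 1
    · obtain ⟨k, hk⟩ := Int.eq_ofNat_of_zero_le hz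
      obtain rfl : z = k - 1 := by omega
      rw [← hW k]
      congr 1
      ext ω
      simp
    · have h1 : (fun ω => (numAboveMean (fun i => U i ω) : ℤ) - 1) ⁻¹' {z} = ∅ := by
        ext ω
        simp only [Set.mem_preimage, Set.mem_singleton_iff, Set.mem_empty_iff_false, iff_false]
        omega
      have h2 : eulerian (n - 1) z = 0 := by
        rw [eulerian, Finset.card_eq_zero, Finset.filter_eq_empty_iff]
        intro σ _
        omega
      simp [h1, h2]
  · simp [Measure.real, hS m hm k]
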